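/- Let $\mathcal A$ be a (locally small) combinatorial and simplicial model category, i.e. a cofibrantly generated model category whose underlying category is locally presentable, equipped with a simplicial enrichment that is tensored and cotensored over simplicial sets and such that for every cofibration $i\colon K\to L$ and fibration $p\colon X\to Y$ the map $$\operatorname{Hom}(L,X)\to \operatorname{Hom}(K,X)\times_{\operatorname{Hom}(K,Y)}\operatorname{Hom}(L,Y)$$ is a Kan fibration, which is trivial if $i$ or $p$ is a weak equivalence. Let $\lambda$ be a regular cardinal such that 1. $\mathcal A$ is locally $\lambda$-presentable; 2. $\mathcal A$ has a set of generating cofibrations with $\lambda$-presentable domains and codomains; 3. an object $X$ of $\mathcal A$ is $\lambda$-presentable if and only if the simplicial functor $\operatorname{Hom}(X,-)\colon\mathcal A\to\mathsf{sSet}$ preserves $\lambda$-filtered colimits. Let $c$ be a simplicially enriched comonad on $\mathcal A$ (a comonad whose underlying endofunctor is simplicially enriched and whose counit and comultiplication are simplicially natural) that preserves $\lambda$-filtered colimits and is a cofibrant replacement, i.e. for each object $X$ the object $cX$ is cofibrant and the counit $cX\to X$ is a weak equivalence. Let $\mathcal A_c$ be the category of $c$-coalgebras, with forgetful functor $u\colon\mathcal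 A_c\to\mathcal A$ and its right adjoint, the cofree coalgebra functor $c\colon\mathcal A\to\mathcal A_c$. Then $\mathcal A_c$ is locally presentable. Moreover $\mathcal A_c$ has a simplicial enrichment (with underlying category $\mathcal A_c$), and $u$ and $c\colon\mathcal A\to\mathcal A_c$ have simplicial enrichments whose composite $uc$ is the given simplicial endofunctor $c$ of $\mathcal A$, such that the adjunction $u\dashv c$ is simplicial (its unit and counit are simplicially natural) and $\mathcal A_c$ is tensored and cotensored over simplicial sets. -/

import Mathlib

open CategoryTheory Limits MonoidalCategory HomotopicalAlgebra

universe v v' u u' u₁ u₂ u₃ v₁ v₂ v₃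

namespace AlgCofibrant

noncomputable section

/-! ### Enriched functors, transformations and adjunctions

Here `V` is a monoidal category, and the `V`-enriched categories have a given underlying ordinary
category (`EnrichedOrdinaryCategory`). -/

section Enriched

variable (V : Type u') [Category.{v'} V] [MonoidalCategory V]
  {C : Type u₁} [Category.{v₁} C] [EnrichedOrdinaryCategory V C]
  {D : Type u₂} [Category.{v₂} D] [EnrichedOrdinaryCategory V D]
  {E : Type u₃} [Category.{v₃} E] [EnrichedOrdinaryCategory V E]

/-- A `V`-enrichment of an ordinary functor `F : C ⥤ D`: a `V`-functor with the same action
on objects, whose underlying ordinary functor is `F`. -/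
structure FunctorEnrichment (F : C ⥤ D) where
  /-- The action on the objects of morphisms. -/
  map (X Y : C) : (X ⟶[V] Y) ⟶ (F.obj X ⟶[V] F.obj Y)
  map_id (X : C) : eId V X ≫ map X X = eId V (F.obj X)
  map_comp (X Y Z : C) :
    eComp V X Y Z ≫ map X Z =
      (map X Y ⊗ₘ map Y Z) ≫ eComp V (F.obj X) (F.obj Y) (F.obj Z)
  /-- The underlying ordinary functor is `F`. -/
  homEquiv_map {X Y : C} (f : X ⟶ Y) :
    eHomEquiv V (F.map f) = eHomEquiv V f ≫ map X Y

namespace FunctorEnrichment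

variable (C) in
/-- The identity `V`-functor. -/
def id : FunctorEnrichment V (𝟭 C) where
  map _ _ := 𝟙 _
  map_id _ := by simp
  map_comp _ _ _ := by simp
  homEquiv_map _ := by simp

variable {V}

/-- The composite of two `V`-functors. -/
def comp {F : C ⥤ D} {G : D ⥤ E} (eF : FunctorEnrichment V F) (eG : FunctorEnrichment V G) :
    FunctorEnrichment V (F ⋙ G) where
  map X Y := eF.map X Y ≫ eG.map (F.obj X) (F.obj Y)
  map_id X := by
    rw [← Category.assoc, eF.map_id, eG.map_id]
    rfl
  map_comp X Y Z := by
    rw [← Category.assoc, eF.map_comp, Category.assoc, eG.map_comp,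
      ← tensorHom_comp_tensorHom, Category.assoc]
    rfl
  homEquiv_map f := by
    rw [Functor.comp_map, eG.homEquiv_map, eF.homEquiv_map, Category.assoc]

end FunctorEnrichment

variable {V}

/-- `α : F ⟶ G` is `V`-natural: the two morphisms `C(X, Y) ⟶ D(F X, G Y)` in `V`, given by
`F` followed by postcomposition with `α_Y`, and by `G` followed by precomposition with `α_X`,
are equal. -/
def IsEnrichedNatural {F G : C ⥤ D} (eF : FunctorEnrichment V F) (eG : FunctorEnrichment V G)
    (α : F ⟶ G) : Prop :=
  ∀ X Y : C,
    eF.map X Y ≫ eHomWhiskerLeft V (F.obj X) (α.app Y) =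
      eG.map X Y ≫ eHomWhiskerRight V (α.app X) (G.obj Y)

/-- The adjunction `F ⊣ G` is a `V`-adjunction, for given `V`-functor structures on `F` and
`G`: its unit and its counit are `V`-natural. -/
structure IsEnrichedAdjunction {F : C ⥤ D} {G : D ⥤ C} (adj : F ⊣ G)
    (eF : FunctorEnrichment V F) (eG : FunctorEnrichment V G) : Prop where
  unit : IsEnrichedNatural (FunctorEnrichment.id V C) (eF.comp eG) adj.unit
  counit : IsEnrichedNatural (eG.comp eF) (FunctorEnrichment.id V D) adj.counit

variable (V) in
/-- A `V`-enrichment of a comonad: a `V`-functor structure on the underlying endofunctor for which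
the counit and the comultiplication are `V`-natural. -/
structure ComonadEnrichment (G : Comonad C) where
  /-- The `V`-functor structure on the underlying endofunctor. -/
  functor : FunctorEnrichment V G.toFunctor
  counit : IsEnrichedNatural functor (FunctorEnrichment.id V C) G.ε
  comult : IsEnrichedNatural functor (functor.comp functor) G.δ

end Enriched

/-! ### Tensors and cotensors -/

section Tensors

variable {V : Type u'} [Category.{v'} V] [MonoidalCategory V] [MonoidalClosed V]
  {C : Type u} [Category.{v} C] [EnrichedOrdinaryCategory V C]

/-- The morphism `C(T, Y) ⟶ [K, C(X, Y)]` induced by `i : K ⟶ C(X, T)` and composition. -/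
def tensorComparison {K : V} {X T : C} (i : K ⟶ (X ⟶[V] T)) (Y : C) :
    (T ⟶[V] Y) ⟶ (ihom K).obj (X ⟶[V] Y) :=
  MonoidalClosed.curry (i ▷ (T ⟶[V] Y) ≫ eComp V X T Y)

/-- `i : K ⟶ C(X, T)` exhibits `T` as the tensor `X ⊗ K`: it induces isomorphisms
`C(T, Y) ≅ [K, C(X, Y)]` in `V`. -/
def IsTensor {K : V} {X T : C} (i : K ⟶ (X ⟶[V] T)) : Prop :=
  ∀ Y : C, IsIso (tensorComparison i Y)

/-- The morphism `C(Y, P) ⟶ [K, C(Y, X)]` induced by `p : K ⟶ C(P, X)` and composition. -/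
def cotensorComparison [BraidedCategory V] {K : V} {X P : C} (p : K ⟶ (P ⟶[V] X)) (Y : C) :
    (Y ⟶[V] P) ⟶ (ihom K).obj (Y ⟶[V] X) :=
  MonoidalClosed.curry ((β_ K (Y ⟶[V] P)).hom ≫ (Y ⟶[V] P) ◁ p ≫ eComp V Y P X)

/-- `p : K ⟶ C(P, X)` exhibits `P` as the cotensor `X ^ K`: it induces isomorphisms
`C(Y, P) ≅ [K, C(Y, X)]` in `V`. -/
def IsCotensor [BraidedCategory V] {K : V} {X P : C} (p : K ⟶ (P ⟶[V] X)) : Prop :=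
  ∀ Y : C, IsIso (cotensorComparison p Y)

variable (V C)

/-- The `V`-category `C` is tensored over `V`. -/
def IsTensored : Prop :=
  ∀ (X : C) (K : V), ∃ (T : C) (i : K ⟶ (X ⟶[V] T)), IsTensor i

/-- The `V`-category `C` is cotensored over `V`. -/
def IsCotensored [BraidedCategory V] : Prop :=
  ∀ (X : C) (K : V), ∃ (P : C) (p : K ⟶ (P ⟶[V] X)), IsCotensor p

end Tensors

/-! ### Combinatorial and simplicial model categories -/

section ModelCategories

variable {A : Type u} [Category.{v} A]

/-- `I` is a set of generating cofibrations. -/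
structure IsGeneratingCofibrations [ModelCategory A] (I : MorphismProperty A) : Prop where
  isSmall : MorphismProperty.IsSmall.{v} I
  smallObjectArgument : MorphismProperty.HasSmallObjectArgument.{v} I
  rlp_eq : I.rlp = trivialFibrations A

/-- `J` is a set of generating trivial cofibrations. -/
structure IsGeneratingTrivialCofibrations [ModelCategory A] (J : MorphismProperty A) : Prop where
  isSmall : MorphismProperty.IsSmall.{v} J
  smallObjectArgument : MorphismProperty.HasSmallObjectArgument.{v} J
  rlp_eq : J.rlp = fibrations A

variable (A)

/-- A combinatorial model category: cofibrantly generated, with a locally presentable underlying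
category. -/
structure IsCombinatorial [ModelCategory A] : Prop where
  isLocallyPresentable : IsLocallyPresentable.{v} A
  exists_generatingCofibrations : ∃ I : MorphismProperty A, IsGeneratingCofibrations I
  exists_generatingTrivialCofibrations :
    ∃ J : MorphismProperty A, IsGeneratingTrivialCofibrations J

variable {A} in
/-- The morphism of simplicial sets `Hom(L, X) ⟶ Hom(K, X) ×_{Hom(K, Y)} Hom(L, Y)` induced by
`i : K ⟶ L` and `p : X ⟶ Y`. -/
def cornerMap [SimplicialCategory A] {K L X Y : A} (i : K ⟶ L) (p : X ⟶ Y) :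
    (L ⟶[SSet.{v}] X) ⟶
      pullback (eHomWhiskerLeft SSet.{v} K p) (eHomWhiskerRight SSet.{v} i Y) :=
  pullback.lift (eHomWhiskerRight SSet.{v} i X) (eHomWhiskerLeft SSet.{v} L p)
    (eHom_whisker_exchange SSet.{v} i p).symm

/-- A simplicial model category: it is tensored and cotensored over simplicial sets, and for
a cofibration `i` and a fibration `p` the corner map is a Kan fibration (right lifting
property against the horn inclusions), and a trivial Kan fibration (right
lifting property against the boundary inclusions) if moreover `i` or `p` is a weak equivalence. -/
structure IsSimplicialModelCategory [ModelCategory A] [SimplicialCategory A] : Prop where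
  isTensored : IsTensored SSet.{v} A
  isCotensored : IsCotensored SSet.{v} A
  fibration_cornerMap {K L X Y : A} (i : K ⟶ L) (p : X ⟶ Y) :
    cofibrations A i → fibrations A p → SSet.modelCategoryQuillen.J.{v}.rlp (cornerMap i p)
  trivialFibration_cornerMap {K L X Y : A} (i : K ⟶ L) (p : X ⟶ Y) :
    cofibrations A i → fibrations A p → (weakEquivalences A i ∨ weakEquivalences A p) →
      SSet.modelCategoryQuillen.I.{v}.rlp (cornerMap i p)

/-- The regular cardinal `κ` is adapted to the combinatorial simplicial model category `A`:
`A` is locally `κ`-presentable, it has a set of generating cofibrations with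
`κ`-presentable domains and codomains, and an object `X` is `κ`-presentable if and only if
the simplicial representable functor `Hom(X, -) : A ⥤ SSet` preserves `κ`-filtered colimits. -/
structure IsAdaptedCardinal [ModelCategory A] [SimplicialCategory A]
    (κ : Cardinal.{v}) [Fact κ.IsRegular] : Prop where
  isCardinalLocallyPresentable : IsCardinalLocallyPresentable A κ
  exists_generatingCofibrations : ∃ I : MorphismProperty A, IsGeneratingCofibrations I ∧
    ∀ ⦃X Y : A⦄ (f : X ⟶ Y), I f → IsCardinalPresentable X κ ∧ IsCardinalPresentable Y κ
  isCardinalPresentable_iff (X : A) :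
    IsCardinalPresentable X κ ↔ (eCoyoneda SSet.{v} X).IsCardinalAccessible κ

variable {A} in
/-- The underlying endofunctor of `c`, with the counit as augmentation, is a cofibrant replacement
functor. -/
structure IsCofibrantReplacement [ModelCategory A] (c : Comonad A) : Prop where
  isCofibrant (X : A) : IsCofibrant (c.obj X)
  weakEquivalence (X : A) : WeakEquivalence (c.ε.app X)

end ModelCategories

end

end AlgCofibrant

namespace AlgCofibrant

noncomputable section

/-! ### Composition and whiskering in enriched categories -/

section Whiskering

variable {V : Type u'} [Category.{v'} V] [MonoidalCategory V]
  {C : Type u₁} [Category.{v₁} C] [EnrichedOrdinaryCategory V C]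
  {D : Type u₂} [Category.{v₂} D] [EnrichedOrdinaryCategory V D]

/-! Presentability. Let `μ = Order.succ κ`; it is uncountable and the comonad still preserves
`μ`-filtered colimits. A coalgebra `X` is underlain by a `μ`-filtered colimit of presentable
objects, and its structure map lifts stagewise to maps from one object of the diagram into `G` of a
later one. The coalgebra axioms hold for these lifts after enlarging the index. Iterating `ω` times
and taking the colimit of the chain gives a coalgebra over `X` whose carrier is `μ`-presentable
because `ω < μ` (`exists_presentable_coalgebra`). Coalgebras with presentable carriers thus form a
strong generator of presentable objects, while colimits are created by the forgetful functor.

Enrichment. The object of coalgebra morphisms is the equalizer of the two maps `C(X, Y) ⟶ C(X, GY)`,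
so enriched statements reduce to statements about generalized elements `L ⟶ C(X, Y)` satisfying
`IsCoalgebraHom`. Tensors are lifted from `C`: the tensor of a carrier inherits a coalgebra
structure. Cotensors are equalizers of maps between cofree coalgebras; these equalizers exist
because a locally presentable category is complete, and tensors reduce the enriched universal
property to the ordinary one. -/

/-- Enriched composition is extranatural in the middle object. -/
lemma eHomWhiskerLeft_whiskerRight_eComp (X : C) {Y Y' : C} (f : Y ⟶ Y') (Z : C) :
    eHomWhiskerLeft V X f ▷ (Y' ⟶[V] Z) ≫ eComp V X Y' Z =
      (X ⟶[V] Y) ◁ eHomWhiskerRight V f Z ≫ eComp V X Y Z := by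
  dsimp [eHomWhiskerLeft, eHomWhiskerRight]
  simp only [comp_whiskerRight, Category.assoc, MonoidalCategory.whiskerLeft_comp]
  rw [← e_assoc V X Y Y' Z]
  simp

/-- Morphisms `K ⟶ C(X, Y)` act as generalized elements, composed by `(φ ⊗ₘ ψ) ≫ eComp`. This lemma
and the next two let ordinary morphisms move through such composites, at the outer ends and in the
middle. -/
lemma tensorHom_comp_eHomWhiskerLeft_eComp {X Y Z Z' : C} {K L : V} (φ : K ⟶ (X ⟶[V] Y))
    (ψ : L ⟶ (Y ⟶[V] Z)) (g : Z ⟶ Z') :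
    (φ ⊗ₘ (ψ ≫ eHomWhiskerLeft V Y g)) ≫ eComp V X Y Z' =
      (φ ⊗ₘ ψ) ≫ eComp V X Y Z ≫ eHomWhiskerLeft V X g := by
  rw [eComp_eHomWhiskerLeft, MonoidalCategory.tensorHom_def, MonoidalCategory.tensorHom_def]
  simp

lemma comp_eHomWhiskerRight_tensorHom_eComp {X' X Y Z : C} {K L : V} (φ : K ⟶ (X ⟶[V] Y))
    (ψ : L ⟶ (Y ⟶[V] Z)) (f : X' ⟶ X) :
    ((φ ≫ eHomWhiskerRight V f Y) ⊗ₘ ψ) ≫ eComp V X' Y Z =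
      (φ ⊗ₘ ψ) ≫ eComp V X Y Z ≫ eHomWhiskerRight V f Z := by
  rw [eComp_eHomWhiskerRight, tensorHom_def', tensorHom_def']
  simp

lemma comp_eHomWhiskerLeft_tensorHom_eComp {X Y Y' Z : C} {K L : V} (φ : K ⟶ (X ⟶[V] Y))
    (ψ : L ⟶ (Y' ⟶[V] Z)) (f : Y ⟶ Y') :
    ((φ ≫ eHomWhiskerLeft V X f) ⊗ₘ ψ) ≫ eComp V X Y' Z =
      (φ ⊗ₘ (ψ ≫ eHomWhiskerRight V f Z)) ≫ eComp V X Y Z := by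
  have h := eHomWhiskerLeft_whiskerRight_eComp (V := V) X f Z
  rw [tensorHom_def', MonoidalCategory.tensorHom_def, comp_whiskerRight,
    MonoidalCategory.whiskerLeft_comp, Category.assoc, Category.assoc, Category.assoc,
    Category.assoc, h, whisker_exchange_assoc]

lemma eHomEquiv_comp_eHomWhiskerLeft {X Y Z : C} (f : X ⟶ Y) (g : Y ⟶ Z) :
    eHomEquiv V f ≫ eHomWhiskerLeft V X g = eHomEquiv V (f ≫ g) := by
  rw [eHomEquiv_comp, eHomWhiskerLeft, rightUnitor_inv_naturality_assoc, MonoidalCategory.tensorHom_def,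
    Category.assoc, unitors_inv_equal]

lemma eHomEquiv_comp_eHomWhiskerRight {X Y Z : C} (f : X ⟶ Y) (g : Y ⟶ Z) :
    eHomEquiv V g ≫ eHomWhiskerRight V f Z = eHomEquiv V (f ≫ g) := by
  rw [eHomEquiv_comp, eHomWhiskerRight, leftUnitor_inv_naturality_assoc, tensorHom_def',
    Category.assoc]

namespace FunctorEnrichment

variable {F : C ⥤ D} (eF : FunctorEnrichment V F)

lemma map_comp_eHomWhiskerLeft (X : C) {Y Y' : C} (g : Y ⟶ Y') :
    eF.map X Y ≫ eHomWhiskerLeft V (F.obj X) (F.map g) =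
      eHomWhiskerLeft V X g ≫ eF.map X Y' := by
  simp only [eHomWhiskerLeft, Category.assoc, eF.map_comp, eF.homEquiv_map,
    MonoidalCategory.whiskerLeft_comp, rightUnitor_inv_naturality_assoc, MonoidalCategory.tensorHom_def,
    whisker_exchange_assoc]

lemma map_comp_eHomWhiskerRight {X X' : C} (f : X ⟶ X') (Y : C) :
    eF.map X' Y ≫ eHomWhiskerRight V (F.map f) (F.obj Y) =
      eHomWhiskerRight V f Y ≫ eF.map X Y := by
  simp only [eHomWhiskerRight, Category.assoc, eF.map_comp, eF.homEquiv_map,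
    comp_whiskerRight, leftUnitor_inv_naturality_assoc, tensorHom_def',
    ← whisker_exchange_assoc]

lemma comp_map_tensorHom_comp_map_eComp {X Y Z : C} {K L : V} (φ : K ⟶ (X ⟶[V] Y))
    (ψ : L ⟶ (Y ⟶[V] Z)) :
    ((φ ≫ eF.map X Y) ⊗ₘ (ψ ≫ eF.map Y Z)) ≫ eComp V (F.obj X) (F.obj Y) (F.obj Z) =
      (φ ⊗ₘ ψ) ≫ eComp V X Y Z ≫ eF.map X Z := by
  rw [eF.map_comp, ← tensorHom_comp_tensorHom_assoc]

end FunctorEnrichment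

end Whiskering

/-! ### Tensors and cotensors in terms of generalized elements -/

section Tensors

variable {V : Type u'} [Category.{v'} V] [MonoidalCategory V] [MonoidalClosed V]
  {C : Type u} [Category.{v} C] [EnrichedOrdinaryCategory V C]

/-- Yoneda in `V`: the comparison map is invertible iff it is bijective on maps out of every `L`,
and uncurrying removes the internal hom. -/
lemma isTensor_iff {K : V} {X T : C} (i : K ⟶ (X ⟶[V] T)) :
    IsTensor i ↔ ∀ (Y : C) (L : V), Function.Bijective
      (fun ψ : L ⟶ (T ⟶[V] Y) ↦ (i ⊗ₘ ψ) ≫ eComp V X T Y) := by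
  refine forall_congr' fun Y ↦ ?_
  rw [isIso_iff_yoneda_map_bijective]
  refine forall_congr' fun L ↦ ?_
  rw [← Function.Bijective.of_comp_iff' ((ihom.adjunction K).homEquiv L (X ⟶[V] Y)).bijective]
  refine iff_of_eq (congrArg _ (funext fun ψ ↦ ?_))
  refine (MonoidalClosed.curry_natural_left ψ _).symm.trans (congrArg MonoidalClosed.curry ?_)
  dsimp only
  rw [tensorHom_def', Category.assoc]

lemma IsTensor.bijective {K : V} {X T : C} {i : K ⟶ (X ⟶[V] T)} (hi : IsTensor i) (Y : C) (L : V) :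
    Function.Bijective
      (fun ψ : L ⟶ (T ⟶[V] Y) ↦ (i ⊗ₘ ψ) ≫ eComp V X T Y) :=
  (isTensor_iff i).1 hi Y L

/-- The universal property of the tensor, at the level of the underlying category. -/
lemma IsTensor.bijective_hom {K : V} {X T : C} {i : K ⟶ (X ⟶[V] T)} (hi : IsTensor i) (Y : C) :
    Function.Bijective (fun f : T ⟶ Y ↦ i ≫ eHomWhiskerLeft V X f) := by
  have h := ((hi.bijective Y (𝟙_ V)).comp (eHomEquiv V (X := T) (Y := Y)).bijective)
  have h' := ((ρ_ K).symm.homCongr (Iso.refl (X ⟶[V] Y))).symm.bijective.comp h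
  convert h' using 2 with f
  simp [eHomWhiskerLeft, MonoidalCategory.tensorHom_def]

variable [BraidedCategory V]

lemma isCotensor_iff {K : V} {X P : C} (p : K ⟶ (P ⟶[V] X)) :
    IsCotensor p ↔ ∀ (Y : C) (L : V), Function.Bijective
      (fun ψ : L ⟶ (Y ⟶[V] P) ↦ (ψ ⊗ₘ p) ≫ eComp V Y P X) := by
  refine forall_congr' fun Y ↦ ?_
  rw [isIso_iff_yoneda_map_bijective]
  refine forall_congr' fun L ↦ ?_
  rw [← Function.Bijective.of_comp_iff' (((β_ K L).symm.homCongr (Iso.refl (Y ⟶[V] X))).trans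
    ((ihom.adjunction K).homEquiv L (Y ⟶[V] X))).bijective]
  refine iff_of_eq (congrArg _ (funext fun ψ ↦ ?_))
  refine (MonoidalClosed.curry_natural_left ψ _).symm.trans (congrArg MonoidalClosed.curry ?_)
  simp [Iso.homCongr_apply, MonoidalCategory.tensorHom_def]

lemma IsCotensor.bijective_hom {K : V} {X P : C} {p : K ⟶ (P ⟶[V] X)} (hp : IsCotensor p) (Y : C) :
    Function.Bijective (fun f : Y ⟶ P ↦ p ≫ eHomWhiskerRight V f X) := by
  have h := (((isCotensor_iff p).1 hp Y (𝟙_ V)).comp (eHomEquiv V (X := Y) (Y := P)).bijective)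
  have h' := ((λ_ K).symm.homCongr (Iso.refl (Y ⟶[V] X))).symm.bijective.comp h
  convert h' using 2 with f
  simp [eHomWhiskerRight, tensorHom_def']

/-- In a tensored `V`-category, the universal property of the cotensor may be checked at the level
of the underlying category. -/
lemma isCotensor_of_bijective_hom (hC : IsTensored V C) {K : V} {X P : C} (p : K ⟶ (P ⟶[V] X))
    (hp : ∀ Y : C, Function.Bijective (fun f : Y ⟶ P ↦ p ≫ eHomWhiskerRight V f X)) :
    IsCotensor p := by
  rw [isCotensor_iff]
  intro Y L
  -- With `T` the tensor of `Y` by `L`, maps `L ⟶ C(Y, P)` are morphisms `T ⟶ P`, hence maps `K ⟶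
  -- C(T, X)` by `hp`, hence maps `L ⊗ K ⟶ C(Y, X)`.
  obtain ⟨T, i, hi⟩ := hC Y L
  rw [← Function.Bijective.of_comp_iff _ (hi.bijective_hom P)]
  have h := (hi.bijective X K).comp (hp T)
  refine (congrArg Function.Bijective (funext fun f ↦ ?_)).mp h
  exact (comp_eHomWhiskerLeft_tensorHom_eComp i p f).symm

end Tensors

/-! ### The enriched category of coalgebras -/

lemma adj_unit_app_f {C : Type u} [Category.{v} C] {G : Comonad C} (X : G.Coalgebra) :
    (G.adj.unit.app X).f = X.a := by
  simp only [Comonad.adj_unit]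
  rfl

section CofreeHomEquiv

variable {C : Type u} [Category.{v} C] {G : Comonad C}

/-- Morphisms from a coalgebra to a cofree coalgebra. -/
def cofreeHomEquiv (X : G.Coalgebra) (Y : C) : (X.A ⟶ Y) ≃ (X ⟶ G.cofree.obj Y) where
  toFun k :=
    { f := X.a ≫ G.map k
      h := by
        have h : X.a ≫ G.map (X.a ≫ G.map k) = (X.a ≫ G.map k) ≫ G.δ.app Y := by
          rw [Functor.map_comp, ← X.coassoc_assoc, Category.assoc, G.δ.naturality]
          rfl
        exact h }
  invFun h := h.f ≫ G.ε.app Y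
  left_inv k := by
    have h : (X.a ≫ G.map k) ≫ G.ε.app Y = k := by
      rw [Category.assoc, G.ε.naturality, X.counit_assoc, Functor.id_map]
    exact h
  right_inv g := by
    have key (f : X.A ⟶ G.obj Y) (h : X.a ≫ G.map f = f ≫ G.δ.app Y) :
        X.a ≫ G.map (f ≫ G.ε.app Y) = f := by
      rw [Functor.map_comp, reassoc_of% h, G.right_counit, Category.comp_id]
    exact Comonad.Coalgebra.Hom.ext (key g.f g.h)

lemma comp_cofreeHomEquiv {X X' : G.Coalgebra} {Y : C} (f : X' ⟶ X) (k : X.A ⟶ Y) :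
    f ≫ cofreeHomEquiv X Y k = cofreeHomEquiv X' Y (f.f ≫ k) := by
  have h : f.f ≫ X.a ≫ G.map k = X'.a ≫ G.map (f.f ≫ k) := by
    rw [Functor.map_comp, f.h_assoc]
  exact Comonad.Coalgebra.Hom.ext h

/-- Turns the equalizer condition for a parallel pair of cofree coalgebras into an equation in `C`:
each composite is the adjunct of `X.a ≫ G.map k ≫ m`. -/
lemma cofreeHomEquiv_comp_cofreeHomEquiv_eq_iff {X : G.Coalgebra} {Y Z : C} (k : X.A ⟶ Y)
    (m n : G.obj Y ⟶ Z) :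
    cofreeHomEquiv X Y k ≫ cofreeHomEquiv (G.cofree.obj Y) Z m =
      cofreeHomEquiv X Y k ≫ cofreeHomEquiv (G.cofree.obj Y) Z n ↔
    X.a ≫ G.map k ≫ m = X.a ≫ G.map k ≫ n := by
  have h (l : G.obj Y ⟶ Z) : cofreeHomEquiv X Y k ≫ cofreeHomEquiv (G.cofree.obj Y) Z l =
      cofreeHomEquiv X Z (X.a ≫ G.map k ≫ l) :=
    (comp_cofreeHomEquiv _ _).trans (congrArg _ (Category.assoc X.a (G.map k) l))
  rw [h, h, (cofreeHomEquiv X Z).apply_eq_iff_eq]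

end CofreeHomEquiv

namespace ComonadEnrichment

section Coalgebra

variable {V : Type u'} [Category.{v'} V] [MonoidalCategory V]
  {C : Type u} [Category.{v} C] [EnrichedOrdinaryCategory V C]
  {G : Comonad C} (ec : ComonadEnrichment V G)

/-- A generalized element `φ` of `C(X, Y)`, for coalgebras `X` and `Y`, is a generalized morphism of
coalgebras if it is compatible with the structure morphisms. -/
def IsCoalgebraHom {X Y : G.Coalgebra} {L : V} (φ : L ⟶ (X.A ⟶[V] Y.A)) : Prop :=
  φ ≫ eHomWhiskerLeft V X.A Y.a =
    φ ≫ ec.functor.map X.A Y.A ≫ eHomWhiskerRight V X.a (G.obj Y.A)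

variable {ec} in
lemma IsCoalgebraHom.precomp {X Y : G.Coalgebra} {L L' : V} {φ : L ⟶ (X.A ⟶[V] Y.A)}
    (hφ : ec.IsCoalgebraHom φ) (f : L' ⟶ L) : ec.IsCoalgebraHom (f ≫ φ) := by
  simp only [IsCoalgebraHom, Category.assoc]
  rw [hφ]

variable {ec} in
/-- Composites of generalized morphisms of coalgebras. -/
lemma IsCoalgebraHom.comp {X Y Z : G.Coalgebra} {K L : V} {φ : K ⟶ (X.A ⟶[V] Y.A)}
    {ψ : L ⟶ (Y.A ⟶[V] Z.A)} (hφ : ec.IsCoalgebraHom φ) (hψ : ec.IsCoalgebraHom ψ) :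
    ec.IsCoalgebraHom ((φ ⊗ₘ ψ) ≫ eComp V X.A Y.A Z.A) := by
  dsimp only [IsCoalgebraHom] at hφ hψ ⊢
  rw [Category.assoc, ← tensorHom_comp_eHomWhiskerLeft_eComp, hψ, ← Category.assoc ψ,
    ← comp_eHomWhiskerLeft_tensorHom_eComp, hφ, ← Category.assoc φ,
    comp_eHomWhiskerRight_tensorHom_eComp]
  have h := ec.functor.comp_map_tensorHom_comp_map_eComp φ ψ
  simp only [Category.assoc, reassoc_of% h]

lemma isCoalgebraHom_eHomEquiv_iff {X Y : G.Coalgebra} (f : X.A ⟶ Y.A) :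
    ec.IsCoalgebraHom (eHomEquiv V f) ↔ X.a ≫ G.map f = f ≫ Y.a := by
  rw [IsCoalgebraHom, eHomEquiv_comp_eHomWhiskerLeft, ← Category.assoc,
    ← ec.functor.homEquiv_map, eHomEquiv_comp_eHomWhiskerRight, (eHomEquiv V).apply_eq_iff_eq]
  exact eq_comm

/-- This is exactly the `V`-naturality of the comultiplication, as the structure map of a cofree
coalgebra is a component of `δ`. -/
lemma isCoalgebraHom_functor_map (X Y : C) :
    ec.IsCoalgebraHom (X := G.cofree.obj X) (Y := G.cofree.obj Y) (ec.functor.map X Y) :=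
  (ec.comult X Y).trans (Category.assoc _ _ _)

variable [HasEqualizers V]

/-- The object of morphisms between two coalgebras. -/
def coalgebraHom (X Y : G.Coalgebra) : V :=
  equalizer (eHomWhiskerLeft V X.A Y.a)
    (ec.functor.map X.A Y.A ≫ eHomWhiskerRight V X.a (G.obj Y.A))

/-- The inclusion of the object of coalgebra morphisms. -/
def coalgebraHomι (X Y : G.Coalgebra) : ec.coalgebraHom X Y ⟶ (X.A ⟶[V] Y.A) :=
  equalizer.ι _ _

instance (X Y : G.Coalgebra) : Mono (ec.coalgebraHomι X Y) :=
  inferInstanceAs (Mono (equalizer.ι _ _))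

lemma isCoalgebraHom_coalgebraHomι (X Y : G.Coalgebra) :
    ec.IsCoalgebraHom (ec.coalgebraHomι X Y) :=
  equalizer.condition _ _

variable {ec} in
/-- The factorization of a generalized morphism of coalgebras through the object of coalgebra
morphisms. -/
def IsCoalgebraHom.lift {X Y : G.Coalgebra} {L : V} {φ : L ⟶ (X.A ⟶[V] Y.A)}
    (hφ : ec.IsCoalgebraHom φ) : L ⟶ ec.coalgebraHom X Y :=
  equalizer.lift φ hφ

variable {ec} in
@[simp]
lemma IsCoalgebraHom.lift_ι {X Y : G.Coalgebra} {L : V} {φ : L ⟶ (X.A ⟶[V] Y.A)}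
    (hφ : ec.IsCoalgebraHom φ) : hφ.lift ≫ ec.coalgebraHomι X Y = φ :=
  equalizer.lift_ι _ _

/-- The identity of a coalgebra. -/
def coalgebraId (X : G.Coalgebra) : 𝟙_ V ⟶ ec.coalgebraHom X X :=
  ((ec.isCoalgebraHom_eHomEquiv_iff (𝟙 X.A)).2 (by simp)).lift

/-- The composition of morphisms of coalgebras. -/
def coalgebraComp (X Y Z : G.Coalgebra) :
    ec.coalgebraHom X Y ⊗ ec.coalgebraHom Y Z ⟶ ec.coalgebraHom X Z :=
  ((ec.isCoalgebraHom_coalgebraHomι X Y).comp (ec.isCoalgebraHom_coalgebraHomι Y Z)).lift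

@[simp]
lemma coalgebraId_ι (X : G.Coalgebra) :
    ec.coalgebraId X ≫ ec.coalgebraHomι X X = eId V X.A :=
  (IsCoalgebraHom.lift_ι _).trans (eHomEquiv_id V X.A)

@[simp]
lemma coalgebraComp_ι (X Y Z : G.Coalgebra) :
    ec.coalgebraComp X Y Z ≫ ec.coalgebraHomι X Z =
      (ec.coalgebraHomι X Y ⊗ₘ ec.coalgebraHomι Y Z) ≫ eComp V X.A Y.A Z.A :=
  IsCoalgebraHom.lift_ι _

/-- The bijection between morphisms of coalgebras and points of the object of morphisms. -/
def coalgebraHomEquiv (X Y : G.Coalgebra) : (X ⟶ Y) ≃ (𝟙_ V ⟶ ec.coalgebraHom X Y) where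
  toFun f := ((ec.isCoalgebraHom_eHomEquiv_iff f.f).2 f.h).lift
  invFun φ :=
    { f := (eHomEquiv V).symm (φ ≫ ec.coalgebraHomι X Y)
      h := (ec.isCoalgebraHom_eHomEquiv_iff _).1 (by
        rw [Equiv.apply_symm_apply]
        exact (ec.isCoalgebraHom_coalgebraHomι X Y).precomp φ) }
  left_inv f := by ext; simp
  right_inv φ := by simp [← cancel_mono (ec.coalgebraHomι X Y)]

@[simp]
lemma coalgebraHomEquiv_ι {X Y : G.Coalgebra} (f : X ⟶ Y) :
    ec.coalgebraHomEquiv X Y f ≫ ec.coalgebraHomι X Y = eHomEquiv V f.f :=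
  IsCoalgebraHom.lift_ι _

/-- The `V`-category of coalgebras over a `V`-comonad. -/
abbrev coalgebraEnrichedCategory : EnrichedOrdinaryCategory V G.Coalgebra where
  Hom := ec.coalgebraHom
  id := ec.coalgebraId
  comp := ec.coalgebraComp
  id_comp X Y := by
    rw [← cancel_mono (ec.coalgebraHomι X Y)]
    simp only [Category.assoc, coalgebraComp_ι, whiskerRight_comp_tensorHom_assoc, coalgebraId_ι,
      Category.id_comp]
    rw [tensorHom_def', Category.assoc, ← leftUnitor_inv_naturality_assoc, e_id_comp, Category.comp_id]
  comp_id X Y := by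
    rw [← cancel_mono (ec.coalgebraHomι X Y)]
    simp only [Category.assoc, coalgebraComp_ι, whiskerLeft_comp_tensorHom_assoc, coalgebraId_ι,
      Category.id_comp]
    rw [MonoidalCategory.tensorHom_def, Category.assoc, ← rightUnitor_inv_naturality_assoc, e_comp_id, Category.comp_id]
  assoc W X Y Z := by
    rw [← cancel_mono (ec.coalgebraHomι W Z)]
    simp only [Category.assoc, coalgebraComp_ι, whiskerRight_comp_tensorHom_assoc,
      whiskerLeft_comp_tensorHom_assoc]
    rw [← tensorHom_comp_whiskerRight_assoc, ← tensorHom_comp_whiskerLeft_assoc,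
      ← associator_inv_naturality_assoc, e_assoc]
  homEquiv := ec.coalgebraHomEquiv _ _
  homEquiv_id X := by
    refine (cancel_mono (ec.coalgebraHomι X X)).1 ?_
    rw [coalgebraHomEquiv_ι]
    exact (eHomEquiv_id V X.A).trans (ec.coalgebraId_ι X).symm
  homEquiv_comp {X Y Z} f g := by
    refine (cancel_mono (ec.coalgebraHomι X Z)).1 ?_
    rw [coalgebraHomEquiv_ι]
    refine (eHomEquiv_comp V f.f g.f).trans ?_
    rw [Category.assoc, Category.assoc]
    refine congrArg _ ?_
    refine Eq.trans ?_ (congrArg _ (ec.coalgebraComp_ι X Y Z).symm)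
    rw [tensorHom_comp_tensorHom_assoc, coalgebraHomEquiv_ι, coalgebraHomEquiv_ι]

/-- The forgetful `V`-functor from coalgebras. -/
def forgetEnrichment :
    letI := ec.coalgebraEnrichedCategory
    FunctorEnrichment V G.forget :=
  letI := ec.coalgebraEnrichedCategory
  { map := ec.coalgebraHomι
    map_id := ec.coalgebraId_ι
    map_comp := ec.coalgebraComp_ι
    homEquiv_map f := (ec.coalgebraHomEquiv_ι f).symm }

/-- The action of the cofree coalgebra functor on objects of morphisms. -/
def cofreeMap (X Y : C) : (X ⟶[V] Y) ⟶ ec.coalgebraHom (G.cofree.obj X) (G.cofree.obj Y) :=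
  (ec.isCoalgebraHom_functor_map X Y).lift

lemma cofreeMap_ι (X Y : C) :
    ec.cofreeMap X Y ≫ ec.coalgebraHomι (G.cofree.obj X) (G.cofree.obj Y) = ec.functor.map X Y :=
  IsCoalgebraHom.lift_ι _

/-- The cofree coalgebra `V`-functor. -/
def cofreeEnrichment :
    letI := ec.coalgebraEnrichedCategory
    FunctorEnrichment V G.cofree :=
  letI := ec.coalgebraEnrichedCategory
  { map := ec.cofreeMap
    map_id X := by
      refine (cancel_mono (ec.coalgebraHomι _ _)).1 ?_
      rw [Category.assoc, cofreeMap_ι]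
      exact (ec.functor.map_id X).trans (ec.coalgebraId_ι (G.cofree.obj X)).symm
    map_comp X Y Z := by
      refine (cancel_mono (ec.coalgebraHomι _ _)).1 ?_
      rw [Category.assoc, cofreeMap_ι, Category.assoc]
      refine (ec.functor.map_comp X Y Z).trans
        (Eq.trans ?_ (congrArg _ (ec.coalgebraComp_ι _ _ _).symm))
      rw [tensorHom_comp_tensorHom_assoc, cofreeMap_ι, cofreeMap_ι]
      rfl
    homEquiv_map {X Y} f := by
      refine (cancel_mono (ec.coalgebraHomι _ _)).1 ?_
      rw [Category.assoc, cofreeMap_ι]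
      exact (ec.coalgebraHomEquiv_ι _).trans (ec.functor.homEquiv_map f) }

lemma cofreeEnrichment_comp_forgetEnrichment_map (X Y : C) :
    letI := ec.coalgebraEnrichedCategory
    (ec.cofreeEnrichment.comp ec.forgetEnrichment).map X Y = ec.functor.map X Y :=
  ec.cofreeMap_ι X Y

lemma eHomWhiskerLeft_ι (X : G.Coalgebra) {Y Y' : G.Coalgebra} (g : Y ⟶ Y') :
    letI := ec.coalgebraEnrichedCategory
    eHomWhiskerLeft V X g ≫ ec.coalgebraHomι X Y' =
      ec.coalgebraHomι X Y ≫ eHomWhiskerLeft V X.A g.f :=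
  letI := ec.coalgebraEnrichedCategory
  (ec.forgetEnrichment.map_comp_eHomWhiskerLeft X g).symm

lemma eHomWhiskerRight_ι {X X' : G.Coalgebra} (f : X ⟶ X') (Y : G.Coalgebra) :
    letI := ec.coalgebraEnrichedCategory
    eHomWhiskerRight V f Y ≫ ec.coalgebraHomι X Y =
      ec.coalgebraHomι X' Y ≫ eHomWhiskerRight V f.f Y.A :=
  letI := ec.coalgebraEnrichedCategory
  (ec.forgetEnrichment.map_comp_eHomWhiskerRight f Y).symm

/-- The unit at a coalgebra is its structure map, so naturality of the unit, tested after the monic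
inclusion into `C(X, GY)`, is the equation defining the equalizer. Naturality of the counit is that
of `ε`. -/
lemma isEnrichedAdjunction :
    letI := ec.coalgebraEnrichedCategory
    IsEnrichedAdjunction G.adj ec.forgetEnrichment ec.cofreeEnrichment :=
  letI := ec.coalgebraEnrichedCategory
  { unit X Y := by
      refine (cancel_mono (ec.coalgebraHomι _ _)).1 ?_
      rw [Category.assoc, Category.assoc, eHomWhiskerRight_ι, eHomWhiskerLeft_ι]
      refine (Category.id_comp _).trans ?_
      refine (congrArg (_ ≫ eHomWhiskerLeft V X.A ·) (adj_unit_app_f Y)).trans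
        ((ec.isCoalgebraHom_coalgebraHomι X Y).trans ?_)
      refine Eq.trans ?_ (Category.assoc _ _ _).symm
      refine congrArg (ec.coalgebraHomι X Y ≫ ·) ?_
      refine Eq.trans ?_ (Category.assoc _ _ _)
      exact congrArg₂ (· ≫ eHomWhiskerRight V · (G.obj Y.A)) (ec.cofreeMap_ι X.A Y.A).symm
        (adj_unit_app_f X).symm
    counit X Y := by
      refine Eq.trans ?_ ((ec.counit X Y).trans ?_)
      · exact congrArg₂ (· ≫ eHomWhiskerLeft V (G.obj X) ·) (ec.cofreeMap_ι X Y)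
          (congrArg (NatTrans.app · Y) G.adj_counit)
      · exact congrArg (_ ≫ eHomWhiskerRight V · Y)
          (congrArg (NatTrans.app · X) G.adj_counit).symm }

end Coalgebra

/-! ### Tensors of coalgebras -/

section Tensor

variable {V : Type u'} [Category.{v'} V] [MonoidalCategory V] [MonoidalClosed V]
  {C : Type u} [Category.{v} C] [EnrichedOrdinaryCategory V C]
  {G : Comonad C} (ec : ComonadEnrichment V G)

/-- The tensor of the underlying object of a coalgebra is a coalgebra. -/
lemma exists_isTensor_isCoalgebraHom (X : G.Coalgebra) {K : V} {T : C} {i : K ⟶ (X.A ⟶[V] T)}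
    (hi : IsTensor i) :
    ∃ (T' : G.Coalgebra) (i' : K ⟶ (X.A ⟶[V] T'.A)), IsTensor i' ∧ ec.IsCoalgebraHom i' := by
  -- The structure map `t` corresponds to `K ⟶ C(X, T) ⟶ C(GX, GT) ⟶ C(X, GT)`; the defining
  -- equation `ht` says precisely that `i` is a generalized coalgebra morphism. Both axioms are then
  -- tested against `i`.
  obtain ⟨t, ht⟩ := (hi.bijective_hom (G.obj T)).2
    (i ≫ ec.functor.map X.A T ≫ eHomWhiskerRight V X.a (G.obj T))
  dsimp only at ht
  refine ⟨{ A := T, a := t, counit := ?_, coassoc := ?_ }, i, hi, ht⟩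
  · refine (hi.bijective_hom T).1 ?_
    have h : ec.functor.map X.A T ≫ eHomWhiskerLeft V (G.obj X.A) (G.ε.app T) =
      eHomWhiskerRight V (G.ε.app X.A) T := (ec.counit X.A T).trans (Category.id_comp _)
    have h' := congrArg (eHomWhiskerRight V · T) X.counit
    dsimp only [Functor.id_obj] at h h' ⊢
    rw [eHomWhiskerRight_comp] at h'
    rw [eHomWhiskerLeft_comp, reassoc_of% ht, ← eHom_whisker_exchange, reassoc_of% h, h']
    simp
  · refine (hi.bijective_hom _).1 ?_
    have h₁ := ec.functor.map_comp_eHomWhiskerLeft X.A t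
    have h₂ := ec.functor.map_comp_eHomWhiskerRight X.a (G.obj T)
    have h₃ : ec.functor.map X.A T ≫ eHomWhiskerLeft V (G.obj X.A) (G.δ.app T) =
      ec.functor.map X.A T ≫ ec.functor.map (G.obj X.A) (G.obj T) ≫
        eHomWhiskerRight V (G.δ.app X.A) (G.obj (G.obj T)) :=
      (ec.comult X.A T).trans (Category.assoc _ _ _)
    have h₄ := congrArg (eHomWhiskerRight V · (G.obj (G.obj T))) X.coassoc
    dsimp only [Functor.comp_obj] at h₃ h₄ ⊢
    rw [eHomWhiskerRight_comp, eHomWhiskerRight_comp] at h₄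
    rw [eHomWhiskerLeft_comp, eHomWhiskerLeft_comp, reassoc_of% ht, reassoc_of% ht,
      ← eHom_whisker_exchange, ← eHom_whisker_exchange, reassoc_of% h₃, h₄, reassoc_of% h₁,
      reassoc_of% ht, reassoc_of% h₂]

/-- The universal property of the tensor for generalized morphisms of coalgebras. -/
lemma isCoalgebraHom_tensorHom_comp_iff {X T Y : G.Coalgebra} {K : V} {i : K ⟶ (X.A ⟶[V] T.A)}
    (hi : IsTensor i) (hi' : ec.IsCoalgebraHom i) {L : V} (ψ : L ⟶ (T.A ⟶[V] Y.A)) :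
    ec.IsCoalgebraHom ((i ⊗ₘ ψ) ≫ eComp V X.A T.A Y.A) ↔ ec.IsCoalgebraHom ψ := by
  refine ⟨fun h ↦ (hi.bijective _ _).1 ?_, fun h ↦ hi'.comp h⟩
  have h₁ := ec.functor.comp_map_tensorHom_comp_map_eComp i ψ
  dsimp only [IsCoalgebraHom] at h hi' ⊢
  rw [tensorHom_comp_eHomWhiskerLeft_eComp, ← Category.assoc ψ,
    ← comp_eHomWhiskerLeft_tensorHom_eComp, hi', ← Category.assoc i,
    comp_eHomWhiskerRight_tensorHom_eComp, reassoc_of% h₁, ← Category.assoc, h, Category.assoc]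

variable [HasEqualizers V]

/-- The hom objects of coalgebras are subobjects of those in `C`, and by
`isCoalgebraHom_tensorHom_comp_iff` the bijection for the underlying tensor restricts to generalized
coalgebra morphisms. -/
lemma isTensor_lift {X T : G.Coalgebra} {K : V} {i : K ⟶ (X.A ⟶[V] T.A)}
    (hi : IsTensor i) (hi' : ec.IsCoalgebraHom i) :
    letI := ec.coalgebraEnrichedCategory
    IsTensor (X := X) (T := T) hi'.lift := by
  let := ec.coalgebraEnrichedCategory
  refine (isTensor_iff _).2 fun Y L ↦ ?_
  have key (ψ : L ⟶ ec.coalgebraHom T Y) :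
      ((hi'.lift ⊗ₘ ψ) ≫ ec.coalgebraComp _ _ _) ≫ ec.coalgebraHomι X Y =
        (i ⊗ₘ (ψ ≫ ec.coalgebraHomι T Y)) ≫ eComp V X.A T.A Y.A := by
    rw [Category.assoc, coalgebraComp_ι, tensorHom_comp_tensorHom_assoc, IsCoalgebraHom.lift_ι]
  refine ⟨fun ψ ψ' h ↦ ?_, fun θ ↦ ?_⟩
  · have h' := congrArg (· ≫ ec.coalgebraHomι X Y) h
    refine (cancel_mono (ec.coalgebraHomι _ _)).1 ((hi.bijective _ _).1 ?_)
    exact (key ψ).symm.trans (h'.trans (key ψ'))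
  · obtain ⟨ψ, hψ⟩ := (hi.bijective Y.A L).2 (θ ≫ ec.coalgebraHomι X Y)
    dsimp only at hψ
    have hψ' := (ec.isCoalgebraHom_tensorHom_comp_iff hi hi' (Y := Y) ψ).1
      (hψ ▸ (ec.isCoalgebraHom_coalgebraHomι X Y).precomp θ)
    refine ⟨hψ'.lift, (cancel_mono (ec.coalgebraHomι _ _)).1 ((key _).trans ?_)⟩
    rw [IsCoalgebraHom.lift_ι, hψ]

lemma isTensored (hC : IsTensored V C) :
    letI := ec.coalgebraEnrichedCategory
    IsTensored V G.Coalgebra := by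
  let := ec.coalgebraEnrichedCategory
  intro X K
  obtain ⟨T, i, hi⟩ := hC X.A K
  obtain ⟨T', i', hi', h⟩ := ec.exists_isTensor_isCoalgebraHom X hi
  exact ⟨T', h.lift, ec.isTensor_lift hi' h⟩

end Tensor

/-! ### Cotensors of coalgebras -/

section Cotensor

variable {V : Type u'} [Category.{v'} V] [MonoidalCategory V] [MonoidalClosed V]
  [BraidedCategory V]
  {C : Type u} [Category.{v} C] [EnrichedOrdinaryCategory V C]
  {G : Comonad C} (ec : ComonadEnrichment V G)

/-- When `P` is the cotensor of `X.A`, `s` is the cotensor of `X.a` and `t` the comparison from `G`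
of a cotensor to the cotensor of `G`. The two sides of the coalgebra condition are maps `K ⟶ C(Y,
GX)`, that is, morphisms into `Q`. -/
lemma isCoalgebraHom_comp_eHomWhiskerRight_iff {X Y : G.Coalgebra} {K : V} {P Q : C}
    {p : K ⟶ (P ⟶[V] X.A)} {q : K ⟶ (Q ⟶[V] G.obj X.A)} (hq : IsCotensor q)
    {s : P ⟶ Q} (hs : q ≫ eHomWhiskerRight V s _ = p ≫ eHomWhiskerLeft V P X.a)
    {t : G.obj P ⟶ Q} (ht : q ≫ eHomWhiskerRight V t _ = p ≫ ec.functor.map P X.A)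
    (k : Y.A ⟶ P) :
    ec.IsCoalgebraHom (X := Y) (p ≫ eHomWhiskerRight V k X.A) ↔
      k ≫ s = Y.a ≫ G.map k ≫ t := by
  have h := ec.functor.map_comp_eHomWhiskerRight k X.A
  rw [← (hq.bijective_hom Y.A).1.eq_iff]
  dsimp only [IsCoalgebraHom]
  rw [eHomWhiskerRight_comp, eHomWhiskerRight_comp, eHomWhiskerRight_comp, reassoc_of% hs,
    Category.assoc, Category.assoc, Category.assoc, reassoc_of% ht, reassoc_of% h,
    eHom_whisker_exchange]

variable [HasEqualizers V]

lemma isCotensored [HasEqualizers G.Coalgebra] (hC : IsTensored V C) (hC' : IsCotensored V C) :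
    letI := ec.coalgebraEnrichedCategory
    IsCotensored V G.Coalgebra := by
  let := ec.coalgebraEnrichedCategory
  intro X K
  obtain ⟨P, p, hp⟩ := hC' X.A K
  obtain ⟨Q, q, hq⟩ := hC' (G.obj X.A) K
  obtain ⟨s, hs⟩ := (hq.bijective_hom P).2 (p ≫ eHomWhiskerLeft V P X.a)
  obtain ⟨t, ht⟩ := (hq.bijective_hom (G.obj P)).2 (p ≫ ec.functor.map P X.A)
  dsimp only at hs ht
  -- The map `s'` is the cofree functor applied to `s`, written as an adjunct; `t'` is the adjunct
  -- of `t`. By `hst`, their equalizer represents generalized coalgebra morphisms indexed by `K`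
  -- into `X`.
  let s' : G.cofree.obj P ⟶ G.cofree.obj Q := cofreeHomEquiv (G.cofree.obj P) Q (G.ε.app P ≫ s)
  let t' : G.cofree.obj P ⟶ G.cofree.obj Q := cofreeHomEquiv (G.cofree.obj P) Q t
  have hst {Y : G.Coalgebra} (k : Y.A ⟶ P) :
      ec.IsCoalgebraHom (X := Y) (p ≫ eHomWhiskerRight V k X.A) ↔
        cofreeHomEquiv Y P k ≫ s' = cofreeHomEquiv Y P k ≫ t' := by
    refine Iff.trans ?_ (cofreeHomEquiv_comp_cofreeHomEquiv_eq_iff k (G.ε.app P ≫ s) t).symm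
    rw [ec.isCoalgebraHom_comp_eHomWhiskerRight_iff hq hs ht, G.ε.naturality_assoc,
      Y.counit_assoc, Functor.id_map]
  let E := equalizer s' t'
  let k : E.A ⟶ P := (cofreeHomEquiv E P).symm (equalizer.ι s' t')
  have hk : ec.IsCoalgebraHom (X := E) (p ≫ eHomWhiskerRight V k X.A) := by
    rw [hst, Equiv.apply_symm_apply, equalizer.condition]
  refine ⟨E, hk.lift, isCotensor_of_bijective_hom (ec.isTensored hC) _ fun Y ↦ ?_⟩
  have key (f : Y ⟶ E) : (hk.lift ≫ eHomWhiskerRight V f X) ≫ ec.coalgebraHomι Y X =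
      p ≫ eHomWhiskerRight V (f.f ≫ k) X.A := by
    have h := hk.lift_ι
    rw [Category.assoc, eHomWhiskerRight_ι, reassoc_of% h, eHomWhiskerRight_comp]
  have hf (f : Y ⟶ E) : cofreeHomEquiv Y P (f.f ≫ k) = f ≫ equalizer.ι s' t' := by
    rw [← comp_cofreeHomEquiv, Equiv.apply_symm_apply]
  refine ⟨fun f f' h ↦ ?_, fun θ ↦ ?_⟩
  · have h' := congrArg (· ≫ ec.coalgebraHomι Y X) h
    have h'' := (hp.bijective_hom Y.A).1 ((key f).symm.trans (h'.trans (key f')))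
    rw [← cancel_mono (equalizer.ι s' t'), ← hf, ← hf, h'']
  · obtain ⟨l, hl⟩ := (hp.bijective_hom Y.A).2 (θ ≫ ec.coalgebraHomι Y X)
    dsimp only at hl
    have hl' := (hst l).1 (hl ▸ (ec.isCoalgebraHom_coalgebraHomι Y X).precomp θ)
    refine ⟨equalizer.lift _ hl', (cancel_mono (ec.coalgebraHomι _ _)).1 ((key _).trans ?_)⟩
    rw [← hl]
    congr 2
    apply (cofreeHomEquiv Y P).injective
    rw [hf, equalizer.lift_ι]

end Cotensor

end ComonadEnrichment

lemma hasCardinalLT_of_countable (T : Type u) [Countable T] {μ : Cardinal.{v}}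
    (hμ : Cardinal.aleph0 < μ) : HasCardinalLT T μ := by
  refine lt_of_le_of_lt (b := Cardinal.aleph0) ?_ ?_
  · simp
  · simpa using hμ

/-! ### Coalgebras over an accessible comonad -/

section Chain

variable {C : Type u} [Category.{v} C] {G : Comonad C} {μ : Cardinal.{v}} [Fact μ.IsRegular]
  [G.toFunctor.IsCardinalAccessible μ] {X : G.Coalgebra} {J : Type v} [SmallCategory J]
  [IsCardinalFiltered J μ] (p : (isCardinalPresentable C μ).ColimitOfShape J X.A)

instance isCardinalPresentable_diag_obj (j : J) : IsCardinalPresentable (p.diag.obj j) μ :=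
  p.prop_diag_obj j

/-- A colimit presentation of `X.A` by presentable objects is compatible with the structure
morphism of `X` up to enlarging the index. -/
lemma exists_lift_structure (j : J) :
    ∃ (k : J) (_ : j ⟶ k) (b : p.diag.obj j ⟶ G.obj (p.diag.obj k)),
      b ≫ G.map (p.ι.app k) = p.ι.app j ≫ X.a := by
  have := isFiltered_of_isCardinalFiltered J μ
  have := G.toFunctor.preservesColimitsOfShape_of_isCardinalAccessible μ J
  obtain ⟨k, b, hb⟩ := IsCardinalPresentable.exists_hom_of_isColimit μ
    (isColimitOfPreserves G.toFunctor p.isColimit) (p.ι.app j ≫ X.a)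
  dsimp at b hb
  refine ⟨IsFiltered.max j k, IsFiltered.leftToMax j k,
    b ≫ G.map (p.diag.map (IsFiltered.rightToMax j k)), ?_⟩
  rw [Category.assoc, ← Functor.map_comp, ← hb]
  congr 2
  exact p.w _

/-- The lifts of the structure morphism of `X` satisfy the axioms of a coalgebra up to enlarging the
index. -/
lemma exists_lift_structure_coassoc (j : J) {Z : C} [IsCardinalPresentable Z μ]
    (α : Z ⟶ p.diag.obj j) (β : Z ⟶ G.obj (p.diag.obj j))
    (h : β ≫ G.map (p.ι.app j) = α ≫ p.ι.app j ≫ X.a) :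
    ∃ (k : J) (w : j ⟶ k) (b : p.diag.obj j ⟶ G.obj (p.diag.obj k)),
      b ≫ G.map (p.ι.app k) = p.ι.app j ≫ X.a ∧
      b ≫ G.ε.app _ = p.diag.map w ∧
      α ≫ b = β ≫ G.map (p.diag.map w) ∧
      α ≫ b ≫ G.δ.app _ = β ≫ G.map b := by
  have := isFiltered_of_isCardinalFiltered J μ
  have := G.toFunctor.preservesColimitsOfShape_of_isCardinalAccessible μ J
  have hp {i k : J} (w : i ⟶ k) : p.diag.map w ≫ p.ι.app k = p.ι.app i := p.w w
  -- Four enlargements follow: lift the structure map, then force the counit axiom, agreement with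
  -- the earlier lift `β`, and coassociativity. Each equation already holds in the colimit, and
  -- presentability of the source makes it hold at a later stage.
  obtain ⟨k₀, w₀, b₀, h₀⟩ := exists_lift_structure p j
  obtain ⟨k₁, w₁, h₁⟩ := IsCardinalPresentable.exists_eq_of_isColimit' μ p.isColimit
    (b₀ ≫ G.ε.app _) (p.diag.map w₀) (by
      have e : G.map (p.ι.app k₀) ≫ G.ε.app X.A = G.ε.app _ ≫ p.ι.app k₀ := G.ε.naturality _
      have e' : (b₀ ≫ G.ε.app _) ≫ p.ι.app k₀ = p.diag.map w₀ ≫ p.ι.app k₀ := by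
        rw [Category.assoc, ← e, reassoc_of% h₀, X.counit, hp]
        exact Category.comp_id _
      exact e')
  let b₁ := b₀ ≫ G.map (p.diag.map w₁)
  have hb₁ : b₁ ≫ G.map (p.ι.app k₁) = p.ι.app j ≫ X.a := by
    rw [Category.assoc, ← Functor.map_comp, hp, h₀]
  obtain ⟨k₂, w₂, h₂⟩ := IsCardinalPresentable.exists_eq_of_isColimit' μ
    (isColimitOfPreserves G.toFunctor p.isColimit)
    (α ≫ b₁) (β ≫ G.map (p.diag.map (w₀ ≫ w₁))) (by
      refine (Category.assoc _ _ _).trans ((congrArg (α ≫ ·) hb₁).trans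
        (h.symm.trans (Eq.trans ?_ (Category.assoc _ _ _).symm)))
      refine congrArg (β ≫ ·) ?_
      refine Eq.trans ?_ (G.map_comp _ _)
      rw [hp])
  let b₂ := b₁ ≫ G.map (p.diag.map w₂)
  have hb₂ : b₂ ≫ G.map (p.ι.app k₂) = p.ι.app j ≫ X.a := by
    rw [Category.assoc, ← Functor.map_comp, hp, hb₁]
  obtain ⟨k₃, w₃, h₃⟩ := IsCardinalPresentable.exists_eq_of_isColimit' μ
    (isColimitOfPreserves G.toFunctor (isColimitOfPreserves G.toFunctor p.isColimit))
    (α ≫ b₂ ≫ G.δ.app _) (β ≫ G.map b₂) (by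
      have e₁ : (α ≫ b₂ ≫ G.δ.app _) ≫ G.map (G.map (p.ι.app k₂)) =
          α ≫ p.ι.app j ≫ X.a ≫ G.δ.app _ := by
        have e : G.map (p.ι.app k₂) ≫ G.δ.app X.A = G.δ.app _ ≫ G.map (G.map (p.ι.app k₂)) :=
          G.δ.naturality _
        rw [Category.assoc, Category.assoc, ← e, reassoc_of% hb₂]
      have e₂ : (β ≫ G.map b₂) ≫ G.map (G.map (p.ι.app k₂)) =
          α ≫ p.ι.app j ≫ X.a ≫ G.map X.a := by
        rw [Category.assoc, ← Functor.map_comp, hb₂, Functor.map_comp, reassoc_of% h]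
      exact e₁.trans ((by rw [X.coassoc] : _ = _).trans e₂.symm))
  refine ⟨k₃, w₀ ≫ w₁ ≫ w₂ ≫ w₃, b₂ ≫ G.map (p.diag.map w₃), ?_, ?_, ?_, ?_⟩
  · rw [Category.assoc, ← Functor.map_comp, hp, hb₂]
  · have e {i k : J} (w : i ⟶ k) : G.map (p.diag.map w) ≫ G.ε.app _ = G.ε.app _ ≫ p.diag.map w :=
      G.ε.naturality _
    rw [Category.assoc] at h₁
    rw [Category.assoc, e, Category.assoc, reassoc_of% (e w₂), Category.assoc, reassoc_of% (e w₁),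
      reassoc_of% h₁]
    simp only [Functor.map_comp]
  · dsimp only [Functor.comp_map] at h₂
    have h₂' : α ≫ b₂ = β ≫ G.map (p.diag.map (w₀ ≫ w₁ ≫ w₂)) := by
      rw [← Category.assoc w₀, Functor.map_comp, Functor.map_comp]
      exact (Category.assoc _ _ _).symm.trans (h₂.trans (Category.assoc _ _ _))
    rw [reassoc_of% h₂']
    simp only [Functor.map_comp, Category.assoc]
  · have e := G.δ.naturality (p.diag.map w₃)
    dsimp only [Functor.comp_map] at e h₃
    rw [Category.assoc, e, Functor.map_comp]
    simpa only [Category.assoc] using h₃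

/-- A morphism `b` lifting the structure morphism of `X` along a transition morphism. -/
structure StructureLift where
  src : J
  tgt : J
  trans : src ⟶ tgt
  hom : p.diag.obj src ⟶ G.obj (p.diag.obj tgt)
  hom_map : hom ≫ G.map (p.ι.app tgt) = p.ι.app src ≫ X.a
  hom_counit : hom ≫ G.ε.app _ = p.diag.map trans

namespace StructureLift

variable {p}

/-- Here the earlier stage is the source of `s`, with its transition map as `α` and its lift as `β`,
so that the last two equations link consecutive lifts. -/
lemma exists_next (s : StructureLift p) :
    ∃ (k : J) (w : s.tgt ⟶ k) (b : p.diag.obj s.tgt ⟶ G.obj (p.diag.obj k)),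
      b ≫ G.map (p.ι.app k) = p.ι.app s.tgt ≫ X.a ∧
      b ≫ G.ε.app _ = p.diag.map w ∧
      p.diag.map s.trans ≫ b = s.hom ≫ G.map (p.diag.map w) ∧
      p.diag.map s.trans ≫ b ≫ G.δ.app _ = s.hom ≫ G.map b :=
  exists_lift_structure_coassoc p s.tgt (p.diag.map s.trans) s.hom (by
    rw [s.hom_map, ← Category.assoc]
    congr 1
    exact (p.w s.trans).symm)

/-- The next lift of the structure morphism. -/
def next (s : StructureLift p) : StructureLift p where
  src := s.tgt
  tgt := s.exists_next.choose
  trans := s.exists_next.choose_spec.choose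
  hom := s.exists_next.choose_spec.choose_spec.choose
  hom_map := s.exists_next.choose_spec.choose_spec.choose_spec.1
  hom_counit := s.exists_next.choose_spec.choose_spec.choose_spec.2.1

/-- The iterated lifts of the structure morphism. -/
def iterate (s : StructureLift p) : ℕ → StructureLift p
  | 0 => s
  | n + 1 => (s.iterate n).next

end StructureLift

/-- The freedom in `α` and `β` serves to make a prescribed map out of `Z` compatible with the
structure map of the colimit of the chain; only the first lift has to be chosen with this in view.
-/
lemma exists_chain (j : J) {Z : C} [IsCardinalPresentable Z μ]
    (α : Z ⟶ p.diag.obj j) (β : Z ⟶ G.obj (p.diag.obj j))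
    (h : β ≫ G.map (p.ι.app j) = α ≫ p.ι.app j ≫ X.a) :
    ∃ (k : ℕ → J) (w : ∀ n, k n ⟶ k (n + 1))
      (b : ∀ n, p.diag.obj (k n) ⟶ G.obj (p.diag.obj (k (n + 1)))) (y : j ⟶ k 0),
      (∀ n, b n ≫ G.map (p.ι.app _) = p.ι.app _ ≫ X.a) ∧
      (∀ n, b n ≫ G.ε.app _ = p.diag.map (w n)) ∧
      (∀ n, p.diag.map (w n) ≫ b (n + 1) = b n ≫ G.map (p.diag.map (w (n + 1)))) ∧
      (∀ n, p.diag.map (w n) ≫ b (n + 1) ≫ G.δ.app _ = b n ≫ G.map (b (n + 1))) ∧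
      α ≫ p.diag.map y ≫ b 0 = β ≫ G.map (p.diag.map (y ≫ w 0)) := by
  obtain ⟨k, w, b, h₁, h₂, h₃, -⟩ := exists_lift_structure_coassoc p j α β h
  let s : StructureLift p := ⟨j, k, w, b, h₁, h₂⟩
  refine ⟨fun n ↦ (s.iterate n).src, fun n ↦ (s.iterate n).trans, fun n ↦ (s.iterate n).hom, 𝟙 j,
    fun n ↦ (s.iterate n).hom_map, fun n ↦ (s.iterate n).hom_counit,
    fun n ↦ (s.iterate n).exists_next.choose_spec.choose_spec.choose_spec.2.2.1,
    fun n ↦ (s.iterate n).exists_next.choose_spec.choose_spec.choose_spec.2.2.2, ?_⟩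
  have h₃' : α ≫ p.diag.map (𝟙 j) ≫ b = β ≫ G.map (p.diag.map (𝟙 j ≫ w)) := by
    rw [Category.id_comp, p.diag.map_id, Category.id_comp, h₃]
  exact h₃'

variable [HasColimitsOfShape ℕ C]

/-- A morphism from a presentable object to the underlying object of a coalgebra factors through
a coalgebra with presentable underlying object. -/
lemma exists_presentable_coalgebra (hμ : Cardinal.aleph0 < μ) (j : J) {Z : C}
    [IsCardinalPresentable Z μ]
    (α : Z ⟶ p.diag.obj j) (β : Z ⟶ G.obj (p.diag.obj j))
    (h : β ≫ G.map (p.ι.app j) = α ≫ p.ι.app j ≫ X.a) :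
    ∃ (L : G.Coalgebra) (_ : IsCardinalPresentable L.A μ) (π : L ⟶ X) (l : p.diag.obj j ⟶ L.A),
      l ≫ π.f = p.ι.app j ∧ (α ≫ l) ≫ L.a = β ≫ G.map l := by
  obtain ⟨k, w, b, y, h₁, h₂, h₃, h₄, h₅⟩ := exists_chain p j α β h
  have hp {i k : J} (w : i ⟶ k) : p.diag.map w ≫ p.ι.app k = p.ι.app i := p.w w
  let D : ℕ ⥤ C := Functor.ofSequence (fun n ↦ p.diag.map (w n))
  have hD (n : ℕ) : D.map (homOfLE n.le_succ) = p.diag.map (w n) :=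
    Functor.ofSequence_map_homOfLE_succ _ n
  let i (n : ℕ) : p.diag.obj (k n) ⟶ colimit D := colimit.ι D n
  have hi (n : ℕ) : p.diag.map (w n) ≫ i (n + 1) = i n := by
    rw [← hD]; exact colimit.w D _
  let cocone {T : C} (f : ∀ n, p.diag.obj (k n) ⟶ T)
      (hf : ∀ n, p.diag.map (w n) ≫ f (n + 1) = f n) : Cocone D :=
    { pt := T
      ι := NatTrans.ofSequence f (fun n ↦ by
        rw [hD]
        exact (hf n).trans (Category.comp_id _).symm) }
  have desc {T : C} (f : ∀ n, p.diag.obj (k n) ⟶ T)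
      (hf : ∀ n, p.diag.map (w n) ≫ f (n + 1) = f n) :
      ∃ g : colimit D ⟶ T, ∀ n, i n ≫ g = f n :=
    ⟨colimit.desc D (cocone f hf), fun n ↦ colimit.ι_desc (cocone f hf) n⟩
  have ext {T : C} {f g : colimit D ⟶ T} (hfg : ∀ n, i n ≫ f = i n ≫ g) : f = g :=
    colimit.hom_ext hfg
  obtain ⟨π, hπ⟩ := desc (fun n ↦ p.ι.app (k n)) (fun n ↦ hp _)
  -- The lifts `b n` shift the index by one, and `h₃` makes them a cocone after mapping into `G` of
  -- the colimit.
  obtain ⟨a, ha⟩ := desc (fun n ↦ b n ≫ G.map (i (n + 1))) (fun n ↦ by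
    rw [reassoc_of% (h₃ n), ← Functor.map_comp, hi])
  have hL : IsCardinalPresentable (colimit D) μ := by
    have (n : ℕ) : IsCardinalPresentable (D.obj n) μ := p.prop_diag_obj (k n)
    refine isCardinalPresentable_of_isColimit _ (colimit.isColimit D) μ ?_
    -- The chain has countably many arrows, fewer than `μ`; this is where uncountability of `μ`
    -- enters.
    refine (hasCardinalLT_of_countable (ℕ × ℕ) hμ).of_injective
      (fun f ↦ (f.left, f.right)) (fun f g hfg ↦ ?_)
    obtain ⟨h, h'⟩ := Prod.ext_iff.1 hfg
    exact Arrow.ext h h' (Subsingleton.elim _ _)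
  let L : G.Coalgebra :=
    { A := colimit D
      a := a
      counit := ext fun n ↦ by
        have e : G.map (i (n + 1)) ≫ G.ε.app (colimit D) = G.ε.app _ ≫ i (n + 1) :=
          G.ε.naturality _
        rw [reassoc_of% (ha n), e, reassoc_of% (h₂ n), hi]
        exact (Category.comp_id _).symm
      -- Since `h₄` compares `b n` with `b (n + 1)`, the axiom on stage `n` is verified after
      -- passing to stage `n + 1`, with values coming from stage `n + 2`.
      coassoc := ext fun n ↦ by
        have e : G.map (i (n + 2)) ≫ G.δ.app (colimit D) = G.δ.app _ ≫ G.map (G.map (i (n + 2))) :=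
          G.δ.naturality _
        have e' : i n ≫ a ≫ G.map a = b n ≫ G.map (b (n + 1)) ≫ G.map (G.map (i (n + 2))) := by
          rw [reassoc_of% (ha n), ← Functor.map_comp, ha, Functor.map_comp]
        rw [e', ← reassoc_of% (h₄ n), ← e, ← reassoc_of% (ha (n + 1)), ← hi n, Category.assoc] }
  refine ⟨L, hL, { f := π, h := ext fun n ↦ ?_ }, p.diag.map y ≫ i 0, ?_, ?_⟩
  · change i n ≫ a ≫ G.map π = i n ≫ π ≫ X.a
    rw [reassoc_of% (ha n), ← Functor.map_comp, hπ, h₁, reassoc_of% (hπ n)]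
  · change (p.diag.map y ≫ i 0) ≫ π = _
    rw [Category.assoc, hπ, hp]
  · change (α ≫ p.diag.map y ≫ i 0) ≫ a = _
    rw [Category.assoc, Category.assoc, ha, reassoc_of% h₅]
    rw [← Functor.map_comp, Functor.map_comp p.diag, Category.assoc, hi]

end Chain

/-! ### A strong generator of presentable coalgebras -/

section LocallyPresentable

variable {C : Type u} [Category.{v} C] {G : Comonad C} {μ : Cardinal.{v}} [Fact μ.IsRegular]
  [G.toFunctor.IsCardinalAccessible μ]

/-- The forgetful functor preserves colimits, so the underlying map factors through a stage. The
coalgebra condition for this factorization holds in the colimit, which `G` preserves, hence at a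
later stage. -/
lemma isCardinalPresentable_coalgebra (X : G.Coalgebra) [IsCardinalPresentable X.A μ] :
    IsCardinalPresentable X μ where
  preservesColimitOfShape J _ _ := ⟨fun {F} ↦ ⟨fun {c} hc ↦ ⟨by
    have := isFiltered_of_isCardinalFiltered J μ
    have := G.toFunctor.preservesColimitsOfShape_of_isCardinalAccessible μ J
    have hc' := isColimitOfPreserves G.forget hc
    have hc'' := isColimitOfPreserves G.toFunctor hc'
    refine Types.FilteredColimit.isColimitOf _ _ (fun f ↦ ?_) (fun i j f g hfg ↦ ?_)
    · change X ⟶ c.pt at f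
      obtain ⟨j, f', hf'⟩ := IsCardinalPresentable.exists_hom_of_isColimit μ hc' f.f
      change X.A ⟶ (F.obj j).A at f'
      replace hf' : f' ≫ (c.ι.app j).f = f.f := hf'
      obtain ⟨k, w, hw⟩ := IsCardinalPresentable.exists_eq_of_isColimit' μ hc''
        (X.a ≫ G.map f') (f' ≫ (F.obj j).a) (by
          have e : (X.a ≫ G.map f') ≫ G.map (c.ι.app j).f =
              (f' ≫ (F.obj j).a) ≫ G.map (c.ι.app j).f := by
            have e' := (c.ι.app j).h
            dsimp at e'
            rw [Category.assoc, ← Functor.map_comp, hf', Category.assoc, e', reassoc_of% hf', f.h]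
          exact e)
      replace hw : (X.a ≫ G.map f') ≫ G.map (F.map w).f =
        (f' ≫ (F.obj j).a) ≫ G.map (F.map w).f := hw
      refine ⟨k, { f := f' ≫ (F.map w).f, h := ?_ }, ?_⟩
      · have e := (F.map w).h
        rw [Functor.map_comp, ← Category.assoc, hw, Category.assoc, Category.assoc, e]
      · refine Comonad.Coalgebra.Hom.ext (hf'.symm.trans ?_)
        have e : (F.map w).f ≫ (c.ι.app k).f = (c.ι.app j).f :=
          congrArg Comonad.Coalgebra.Hom.f (c.w w)
        change f' ≫ (c.ι.app j).f = (f' ≫ (F.map w).f) ≫ (c.ι.app k).f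
        rw [Category.assoc, e]
    · change X ⟶ F.obj i at f
      change X ⟶ F.obj j at g
      replace hfg : f ≫ c.ι.app i = g ≫ c.ι.app j := hfg
      obtain ⟨k, a, b, hab⟩ := IsCardinalPresentable.exists_eq_of_isColimit μ hc' f.f g.f
        (congrArg Comonad.Coalgebra.Hom.f hfg)
      exact ⟨k, a, b, Comonad.Coalgebra.Hom.ext hab⟩⟩⟩⟩

variable [IsCardinalLocallyPresentable C μ]

lemma exists_factorization (hμ : Cardinal.aleph0 < μ) (X : G.Coalgebra) {M : C}
    [IsCardinalPresentable M μ] (f : M ⟶ X.A) :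
    ∃ (L : G.Coalgebra) (_ : IsCardinalPresentable L.A μ) (π : L ⟶ X) (g : M ⟶ L.A),
      g ≫ π.f = f := by
  obtain ⟨J, _, _, ⟨p⟩⟩ :=
    (isCardinalFilteredGenerator_isCardinalPresentable C μ).exists_colimitsOfShape X.A
  obtain ⟨j, f', hf'⟩ := IsCardinalPresentable.exists_hom_of_isColimit μ p.isColimit f
  obtain ⟨k, w, b, hb⟩ := exists_lift_structure p j
  have hw : p.diag.map w ≫ p.ι.app k = p.ι.app j := p.w w
  obtain ⟨L, hL, π, l, h, -⟩ := exists_presentable_coalgebra p hμ k (p.diag.map w) b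
    (by rw [hb, reassoc_of% hw])
  refine ⟨L, hL, π, f' ≫ p.diag.map w ≫ l, ?_⟩
  rw [Category.assoc, Category.assoc, h, hw]
  exact hf'

/-- Factor `h.f` through a stage `k` of the diagram where `g₁` and `g₂` already agree, and build the
chain from there. The choice `β = Y.a ≫ G.map y'` makes the map from `Y` to the colimit a coalgebra
morphism. -/
lemma exists_equalizing (hμ : Cardinal.aleph0 < μ) {X Y : G.Coalgebra}
    [IsCardinalPresentable Y.A μ] (h : Y ⟶ X) {M : C} [IsCardinalPresentable M μ]
    (g₁ g₂ : M ⟶ Y.A) (hg : g₁ ≫ h.f = g₂ ≫ h.f) :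
    ∃ (L : G.Coalgebra) (_ : IsCardinalPresentable L.A μ) (π : L ⟶ X) (l : Y ⟶ L),
      l ≫ π = h ∧ g₁ ≫ l.f = g₂ ≫ l.f := by
  obtain ⟨J, _, _, ⟨p⟩⟩ :=
    (isCardinalFilteredGenerator_isCardinalPresentable C μ).exists_colimitsOfShape X.A
  obtain ⟨j, y, hy⟩ := IsCardinalPresentable.exists_hom_of_isColimit μ p.isColimit h.f
  replace hy : y ≫ p.ι.app j = h.f := hy
  obtain ⟨k, w, hw⟩ := IsCardinalPresentable.exists_eq_of_isColimit' μ p.isColimit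
    (g₁ ≫ y) (g₂ ≫ y) (by
      refine (Category.assoc _ _ _).trans (Eq.trans ?_ (Category.assoc _ _ _).symm)
      exact (congrArg (g₁ ≫ ·) hy).trans (hg.trans (congrArg (g₂ ≫ ·) hy.symm)))
  let y' := y ≫ p.diag.map w
  have hy' : y' ≫ p.ι.app k = h.f :=
    (Category.assoc _ _ _).trans ((congrArg (y ≫ ·) (p.w w)).trans hy)
  obtain ⟨L, hL, π, l, h₁, h₂⟩ := exists_presentable_coalgebra p hμ k y' (Y.a ≫ G.map y')
    (by rw [Category.assoc, ← Functor.map_comp, hy', h.h, reassoc_of% hy'])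
  refine ⟨L, hL, π, { f := y' ≫ l, h := ?_ }, ?_, ?_⟩
  · rw [h₂, Functor.map_comp, Category.assoc]
  · ext
    change (y' ≫ l) ≫ π.f = h.f
    rw [Category.assoc, h₁, hy']
  · change g₁ ≫ y' ≫ l = g₂ ≫ y' ≫ l
    have hw' : g₁ ≫ y' = g₂ ≫ y' := by simpa only [y', Category.assoc] using hw
    rw [reassoc_of% hw']

/-- Two morphisms of coalgebras are equal if they agree on coalgebras with presentable underlying
objects. -/
lemma coalgebra_hom_ext (hμ : Cardinal.aleph0 < μ) {X Y : G.Coalgebra} {f g : X ⟶ Y}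
    (h : ∀ (L : G.Coalgebra) [IsCardinalPresentable L.A μ] (π : L ⟶ X), π ≫ f = π ≫ g) :
    f = g := by
  ext
  refine (isCardinalFilteredGenerator_isCardinalPresentable C μ).isStrongGenerator.isSeparating
    _ _ fun M hM m ↦ ?_
  have : IsCardinalPresentable M μ := hM
  obtain ⟨L, hL, π, m', rfl⟩ := exists_factorization hμ X m
  have h' := congrArg Comonad.Coalgebra.Hom.f (h L π)
  rw [Comonad.Coalgebra.comp_f, Comonad.Coalgebra.comp_f] at h'
  rw [Category.assoc, Category.assoc, h']

/-- A monomorphism of coalgebras through which all morphisms from coalgebras with presentable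
underlying objects factor is an isomorphism. -/
lemma isIso_of_mono_of_surjective (hμ : Cardinal.aleph0 < μ) {X Y : G.Coalgebra} (i : Y ⟶ X)
    [Mono i] (h : ∀ (L : G.Coalgebra) [IsCardinalPresentable L.A μ] (π : L ⟶ X),
      ∃ π' : L ⟶ Y, π' ≫ i = π) : IsIso i := by
  have hC := (isCardinalFilteredGenerator_isCardinalPresentable C μ).isStrongGenerator
  -- A left adjoint such as the forgetful functor need not preserve monomorphisms. The pair `g₁`,
  -- `g₂` is factored through one presentable coalgebra using `M ⨿ M`, equalized in a presentable
  -- coalgebra over `X`, and brought back over `Y` by `h` and cancellation of `i`.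
  have hi : Mono i.f := by
    rw [hC.isSeparating.mono_iff]
    intro M hM g₁ g₂ hg
    have : IsCardinalPresentable M μ := hM
    have : IsCardinalPresentable (M ⨿ M) μ := by
      have (j : Discrete WalkingPair) : IsCardinalPresentable ((pair M M).obj j) μ := by
        obtain ⟨_ | _⟩ := j <;> exact hM
      exact isCardinalPresentable_of_isColimit _ (colimit.isColimit (pair M M)) μ
        (hasCardinalLT_of_countable _ hμ)
    obtain ⟨L, hL, π, m, hm⟩ := exists_factorization hμ Y (coprod.desc g₁ g₂)
    obtain rfl : (coprod.inl ≫ m) ≫ π.f = g₁ := by rw [Category.assoc, hm, coprod.inl_desc]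
    obtain rfl : (coprod.inr ≫ m) ≫ π.f = g₂ := by rw [Category.assoc, hm, coprod.inr_desc]
    obtain ⟨L', hL', π', l, hl, hl'⟩ := exists_equalizing hμ (π ≫ i) (coprod.inl ≫ m)
      (coprod.inr ≫ m) (by simpa only [Category.assoc, Comonad.Coalgebra.comp_f] using hg)
    obtain ⟨π'', rfl⟩ := h L' π'
    obtain rfl : l ≫ π'' = π := by rw [← cancel_mono i, Category.assoc, hl]
    rw [Comonad.Coalgebra.comp_f, ← Category.assoc, hl', Category.assoc]
  have : IsIso i.f := hC.isIso_of_mono i.f fun M hM m ↦ by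
    have : IsCardinalPresentable M μ := hM
    obtain ⟨L, hL, π, m', rfl⟩ := exists_factorization hμ X m
    obtain ⟨π', rfl⟩ := h L π
    exact ⟨m' ≫ π'.f, Category.assoc _ _ _⟩
  exact G.coalgebra_iso_of_iso i

/-- A coalgebra is determined by its carrier and one morphism from a `v`-small hom-set. -/
lemma small_coalgebra (Q : ObjectProperty C) [ObjectProperty.Small.{v} Q] :
    ObjectProperty.Small.{v} (fun X : G.Coalgebra ↦ Q X.A) := by
  let f : Subtype (fun X : G.Coalgebra ↦ Q X.A) → Σ X : Subtype Q, (X.1 ⟶ G.obj X.1) :=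
    fun X ↦ ⟨⟨X.1.A, X.2⟩, X.1.a⟩
  refine small_of_injective (f := f) ?_
  rintro ⟨⟨A, a, _, _⟩, hA⟩ ⟨⟨B, b, _, _⟩, hB⟩ h
  simp only [f, Sigma.mk.injEq, Subtype.mk.injEq] at h
  obtain ⟨rfl, h⟩ := h
  obtain rfl := eq_of_heq h
  rfl

/-- A coalgebra structure can be transported along an isomorphism. -/
lemma exists_coalgebra_iso (X : G.Coalgebra) {B : C} (e : X.A ≅ B) :
    ∃ Y : G.Coalgebra, Y.A = B ∧ Nonempty (X ≅ Y) := by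
  have hε : G.map e.hom ≫ G.ε.app B = G.ε.app X.A ≫ e.hom := G.ε.naturality _
  have hδ : G.map e.hom ≫ G.δ.app B = G.δ.app X.A ≫ G.map (G.map e.hom) := G.δ.naturality _
  refine ⟨{ A := B, a := e.inv ≫ X.a ≫ G.map e.hom, counit := ?_, coassoc := ?_ }, rfl,
    ⟨Comonad.Coalgebra.isoMk e ?_⟩⟩
  · rw [Category.assoc, Category.assoc, hε, X.counit_assoc, e.inv_hom_id]
  · simp only [Category.assoc, Functor.map_comp]
    rw [hδ, X.coassoc_assoc, ← G.map_comp_assoc e.hom, e.hom_inv_id, G.map_id, Category.id_comp]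
  · exact (e.hom_inv_id_assoc _).symm

variable (G μ) in
lemma isCardinalLocallyPresentable_coalgebra (hμ : Cardinal.aleph0 < μ) :
    IsCardinalLocallyPresentable G.Coalgebra μ := by
  have : HasColimitsOfSize.{v, v} G.Coalgebra :=
    hasColimits_of_hasColimits_createsColimits G.forget
  obtain ⟨Q, _, hQ, hQ'⟩ := ObjectProperty.EssentiallySmall.exists_small_le.{v}
    (isCardinalPresentable C μ)
  have key (L : G.Coalgebra) [IsCardinalPresentable L.A μ] :
      ∃ L' : G.Coalgebra, Q L'.A ∧ Nonempty (L ≅ L') := by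
    obtain ⟨B, hB, ⟨e⟩⟩ := hQ' L.A ‹_›
    obtain ⟨L', rfl, e'⟩ := exists_coalgebra_iso L e
    exact ⟨L', hB, e'⟩
  rw [IsCardinalLocallyPresentable.iff_exists_isStrongGenerator]
  refine ⟨fun X ↦ Q X.A, small_coalgebra Q,
    ObjectProperty.isStrongGenerator_iff.2 ⟨fun X Y f g h ↦ ?_, fun X Y i _ h ↦ ?_⟩, fun X hX ↦ ?_⟩
  · refine coalgebra_hom_ext hμ fun L _ π ↦ ?_
    obtain ⟨L', hL', ⟨e⟩⟩ := key L
    rw [← cancel_epi e.inv]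
    simpa using h L' hL' (e.inv ≫ π)
  · refine isIso_of_mono_of_surjective hμ i fun L _ π ↦ ?_
    obtain ⟨L', hL', ⟨e⟩⟩ := key L
    obtain ⟨π', hπ'⟩ := h L' hL' (e.inv ≫ π)
    exact ⟨e.hom ≫ π', by simp_all⟩
  · have : IsCardinalPresentable X.A μ := hQ _ hX
    exact isCardinalPresentable_coalgebra X

end LocallyPresentable

/-- Locally presentable categories are complete. -/
lemma hasLimits_of_isCardinalLocallyPresentable (C : Type u) [Category.{v} C] (μ : Cardinal.{v})
    [Fact μ.IsRegular] [IsCardinalLocallyPresentable C μ] : HasLimitsOfSize.{v, v} C := by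
  -- The Yoneda functor restricted to a small model of the presentable objects is fully faithful, by
  -- density, and has a left adjoint, so `C` is reflective in a presheaf category.
  let F := (equivSmallModel.{v} (isCardinalPresentable C μ).FullSubcategory).inverse ⋙
    (isCardinalPresentable C μ).ι
  let R := Presheaf.restrictedULiftYoneda.{v} F
  have : R.IsRightAdjoint :=
    ⟨_, ⟨Presheaf.uliftYonedaAdjunction.{v} (uliftYoneda.leftKanExtension F)
      (uliftYoneda.leftKanExtensionUnit F)⟩⟩
  have : Reflective R := ⟨_, Adjunction.ofIsRightAdjoint R⟩
  exact hasLimits_of_reflective R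

end

end AlgCofibrant

theorem mainTheorem4 {A : Type u} [Category.{v} A] [ModelCategory A] [SimplicialCategory A]
    (hA : AlgCofibrant.IsCombinatorial A) (hA' : AlgCofibrant.IsSimplicialModelCategory A)
    (κ : Cardinal.{v}) [Fact κ.IsRegular] (hκ : AlgCofibrant.IsAdaptedCardinal A κ)
    (c : Comonad A) (ec : AlgCofibrant.ComonadEnrichment SSet.{v} c)
    (hc : AlgCofibrant.IsCofibrantReplacement c)
    (hcκ : c.toFunctor.IsCardinalAccessible κ) :
    IsLocallyPresentable.{v} c.Coalgebra ∧
    ∃ (_ : SimplicialCategory c.Coalgebra)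
      (eForget : AlgCofibrant.FunctorEnrichment SSet.{v} c.forget)
      (eCofree : AlgCofibrant.FunctorEnrichment SSet.{v} c.cofree),
      AlgCofibrant.IsEnrichedAdjunction c.adj eForget eCofree ∧
      (∀ X Y : A, (eCofree.comp eForget).map X Y = ec.functor.map X Y) ∧
      AlgCofibrant.IsTensored SSet.{v} c.Coalgebra ∧
      AlgCofibrant.IsCotensored SSet.{v} c.Coalgebra := by
  have hκ₀ : Cardinal.aleph0 ≤ κ := Cardinal.IsRegular.aleph0_le Fact.out
  -- Since `κ` may be `ℵ₀`, its successor is used to have room for countable chains.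
  have hμ : Cardinal.aleph0 < Order.succ κ := hκ₀.trans_lt (Order.lt_succ κ)
  have : Fact (Order.succ κ).IsRegular := ⟨Cardinal.isRegular_succ hκ₀⟩
  have := hκ.isCardinalLocallyPresentable
  have := IsCardinalLocallyPresentable.of_le A (Order.le_succ κ)
  have := c.toFunctor.isCardinalAccessible_of_le (Order.le_succ κ)
  have := AlgCofibrant.isCardinalLocallyPresentable_coalgebra c (Order.succ κ) hμ
  have := AlgCofibrant.hasLimits_of_isCardinalLocallyPresentable c.Coalgebra (Order.succ κ)
  have : HasEqualizers c.Coalgebra := inferInstance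
  exact ⟨⟨Order.succ κ, inferInstance, inferInstance⟩, ec.coalgebraEnrichedCategory,
    ec.forgetEnrichment, ec.cofreeEnrichment, ec.isEnrichedAdjunction,
    ec.cofreeEnrichment_comp_forgetEnrichment_map, ec.isTensored hA'.isTensored,
    ec.isCotensored hA'.isTensored hA'.isCotensored⟩
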